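/- Let $\mathcal G=(\mathcal V,\mathcal E)$ be a finite simple graph with $n$ vertices. For a configuration $p=(p_i)_{i\in\mathcal V}\in(\mathbb R^d)^n=\mathbb R^{dn}$ let $F(p)=(\|p_j-p_i\|^2)_{ij\in\mathcal E}\in\mathbb R^{|\mathcal E|}$ be the distance map, and let $R(p)\in\mathbb R^{|\mathcal E|\times dn}$ be the rigidity matrix: the row of the edge $ij$ has the entries $(p_i-p_j)^\top$ in the columns of $i$, $(p_j-p_i)^\top$ in the columns of $j$, and zeros elsewhere; thus $\mathrm dF_p=2R(p)$ and $R(p)p=F(p)$. A configuration is a regular point of $F$ if the rank of $\mathrm dF_p$ is maximal there. Two configurations are congruent if all their pairwise distances agree. The framework $(\mathcal G,p)$ is locally rigid if every configuration $q$ sufficiently close to $p$ with $F(q)=F(p)$ is congruent to $p$. The graph $\mathcal G$ is generically $d$-rigid if $(\mathcal G,p)$ is locally rigid for all $p\in\mathbb R^{dn}$ outside the zero set of some nonzero polynomial with rational coefficients. Given an orientation of the edges of $\mathcal G$, let $\overrightarrow R(p)$ be obtained from $R(p)$ by replacing with zeros, in the row of each edge oriented from $i$ to $j$, the entries in the columns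 of $j$. **Theorem 3 (Exponential stability of the directed controller).** Assume that $\mathcal G$ is generically $d$-rigid and that $p^*$ is a regular point of $F$; put $m^*=F(p^*)$, and fix an orientation of $\mathcal G$. Let $P$ be a matrix whose columns are linearly independent and span the column space of $R(p^*)$, and let $Z=2R(p^*)\overrightarrow R(p^*)^\top$. If $\tfrac12P^\top(Z+Z^\top)P$ is positive definite, then trajectories of the directed controller $$\dot p=-\overrightarrow R(p)^\top\,(F(p)-m^*)$$ starting sufficiently close to $p^*$ converge exponentially to a configuration $q$ with $F(q)=m^*$. That is, there are $\delta,K,k>0$ such that, for every $p^0$ with $\|p^0-p^*\|<\delta$, a solution $p(t)$ with $p(0)=p^0$ exists for all $t\ge0$, and for every such solution there is a configuration $q$ with $F(q)=m^*$ and $\|p(t)-q\|\le Ke^{-kt}$ for all $t\ge 0$. -/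

import Mathlib

open scoped Matrix

noncomputable section

namespace FormationControl

variable {V : Type*} [Fintype V] [DecidableEq V] {d : ℕ}

/-- Configurations of agents indexed by `V` in `ℝ^d`: vectors of `ℝ^(d|V|)` with the Euclidean
norm. The entry `(i, k)` is the `k`-th coordinate of agent `i`. -/
abbrev Config (V : Type*) (d : ℕ) : Type _ := EuclideanSpace ℝ (V × Fin d)

/-- The position in `ℝ^d` of agent `i` in the configuration `p`. -/
def pos (p : Config V d) (i : V) : EuclideanSpace ℝ (Fin d) :=
  WithLp.toLp 2 fun k => p (i, k)

/-- The distance (rigidity) map: the vector of squared lengths `‖p_j - p_i‖ ^ 2`, indexed by the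
edges `ij` of `G`. -/
def distanceMap (G : SimpleGraph V) (p : Config V d) : G.edgeSet → ℝ := fun e =>
  Sym2.lift ⟨fun i j => ‖pos p j - pos p i‖ ^ 2, fun i j => by simp only [norm_sub_rev]⟩ e.1

/-- The rigidity matrix `R(p)`. The row of the edge `ij` has the entries `p_i - p_j` in the
columns of agent `i`, the entries `p_j - p_i` in the columns of agent `j`, and zeros elsewhere. -/
def rigidityMatrix (G : SimpleGraph V) (p : Config V d) : Matrix G.edgeSet (V × Fin d) ℝ :=
  fun e c => Sym2.lift
    ⟨fun i j => ((if c.1 = i then 1 else 0) - (if c.1 = j then 1 else 0)) *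
        (p (i, c.2) - p (j, c.2)), fun i j => by ring⟩ e.1

/-- An orientation of `G`: the choice, for every edge, of the endpoint at which it starts. -/
structure EdgeOrientation (G : SimpleGraph V) where
  /-- The start of an edge. -/
  tail : G.edgeSet → V
  tail_mem : ∀ e : G.edgeSet, tail e ∈ e.1

/-- The directed rigidity matrix: in every row of `R(p)`, the entries of the endpoint at which the
oriented edge ends are replaced by zero. -/
def directedRigidityMatrix {G : SimpleGraph V} (o : EdgeOrientation G) (p : Config V d) :
    Matrix G.edgeSet (V × Fin d) ℝ :=
  fun e c => if c.1 = o.tail e then rigidityMatrix G p e c else 0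

/-- Two configurations are congruent if all their pairwise distances agree. -/
def Congruent (p q : Config V d) : Prop :=
  ∀ i j : V, ‖pos p i - pos p j‖ = ‖pos q i - pos q j‖

/-- The framework `(G, p)` is locally rigid: every configuration close to `p` with the same edge
lengths is congruent to `p`. -/
def LocallyRigid (G : SimpleGraph V) (p : Config V d) : Prop :=
  ∃ ε > 0, ∀ q ∈ Metric.ball p ε, distanceMap G q = distanceMap G p → Congruent q p

/-- `G` is generically `d`-rigid: all frameworks `(G, p)` in `ℝ^d` are locally rigid, except
possibly those with `p` in the zero set of one nonzero polynomial with rational coefficients. -/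
def GenericallyRigid (G : SimpleGraph V) (d : ℕ) : Prop :=
  ∃ f : MvPolynomial (V × Fin d) ℚ, f ≠ 0 ∧
    ∀ p : Config V d, MvPolynomial.aeval (fun c => p c) f ≠ 0 → LocallyRigid G p

/-- `p` is a regular point of the distance map: the rank of the differential is maximal at `p`. -/
def IsRegularPoint (G : SimpleGraph V) [Fintype G.edgeSet] (p : Config V d) : Prop :=
  ∀ q : Config V d,
    Module.finrank ℝ (fderiv ℝ (distanceMap G : Config V d → G.edgeSet → ℝ) q).range ≤
      Module.finrank ℝ (fderiv ℝ (distanceMap G : Config V d → G.edgeSet → ℝ) p).range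

/-- The right-hand side `p ↦ -(directed R(p))ᵀ (F(p) - m)` of the directed controller with the
vector `m` of target squared lengths. -/
def directedField {G : SimpleGraph V} [Fintype G.edgeSet] (o : EdgeOrientation G)
    (m : G.edgeSet → ℝ) (p : Config V d) : Config V d :=
  WithLp.toLp 2 (-((directedRigidityMatrix o p)ᵀ *ᵥ (distanceMap G p - m)))

/-- `x` restricted to `[0, ∞)` is a trajectory of the directed controller starting at `p₀`
(the derivative at time `0` is one-sided). -/
def IsTrajectory {G : SimpleGraph V} [Fintype G.edgeSet] (o : EdgeOrientation G)
    (m : G.edgeSet → ℝ) (p₀ : Config V d) (x : ℝ → Config V d) : Prop :=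
  x 0 = p₀ ∧ ∀ t : ℝ, 0 ≤ t → HasDerivWithinAt x (directedField o m (x t)) (Set.Ici 0) t

/-- `P` is a basis matrix of the column space of `A`: its columns are linearly independent and
span the column space of `A`. -/
def IsColumnBasis {E C : Type*} {r : ℕ} (P : Matrix E (Fin r) ℝ) (A : Matrix E C ℝ) : Prop :=
  LinearIndependent ℝ P.col ∧
    Submodule.span ℝ (Set.range P.col) = Submodule.span ℝ (Set.range A.col)

end FormationControl

end

/-! Let `e = F(p) - m*`. Along a trajectory `e' = -2 R(p) (directed R(p))ᵀ e`, and at `p*` the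
matrix is `-Z`. The hypothesis makes the quadratic form of `Z` positive only on the column space of
`R(p*)`, the range of `dF` at `p*`, while `e` need not lie in that space. Maximality of the rank at
`p*` repairs this: as in the constant rank theorem, the values of `F` near `p*` form a set tangent
to that range, so `e(p)` lies in it up to `o(‖e(p)‖)`
(`ContDiff.exists_isLittleO_of_finrank_range_le`). Hence the form is bounded below by `c ‖e‖²`
throughout a ball around `p*` (`exists_eventually_mul_sq_norm_le_inner`).

Inside the ball `‖e‖` therefore decays like `exp(-ct)`, and the speed is at most `C ‖e‖`, so the
total displacement is at most `C/c ‖e(0)‖`. A trajectory starting close to `p*` thus never leaves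
the ball and converges to a zero of `e` (`mem_ball_and_norm_sub_le_of_dissipation`,
`exists_exponential_stability`). -/

section

open Filter Topology Metric Set

/-! ### Global solutions for compactly supported fields. -/

section ODE

variable {E : Type*} [NormedAddCommGroup E] [NormedSpace ℝ E] [CompleteSpace E]

open scoped Manifold in
/-- A compactly supported `C¹` vector field is complete. -/
theorem ContDiff.exists_forall_hasDerivAt_of_hasCompactSupport {v : E → E}
    (hv : ContDiff ℝ 1 v) (hc : HasCompactSupport v) (x : E) :
    ∃ γ : ℝ → E, γ 0 = x ∧ ∀ t, HasDerivAt γ (v (γ t)) t := by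
  obtain ⟨K, hK⟩ := hv.lipschitzWith_of_hasCompactSupport hc one_ne_zero
  obtain ⟨M, hM⟩ := hc.exists_bound_of_continuous hv.continuous
  have hloc : ∀ a : ℝ, ∃ γ : ℝ → E, γ 0 = x ∧
      IsMIntegralCurveOn (I := 𝓘(ℝ, E)) γ v (Ioo (-a) a) := by
    intro a
    have h0 : (0 : ℝ) ∈ Icc (-|a|) |a| := by simp
    -- Speed at most `M` confines the curve to radius `M |a|` during time `|a|`, so any interval
    -- length is admissible. The absolute value keeps `0` in the interval when `a` is negative.
    have hp : IsPicardLindelof (fun _ : ℝ => v) (⟨0, h0⟩ : Icc (-|a|) |a|) x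
        (M.toNNReal * a.nnabs) 0 M.toNNReal K := by
      refine IsPicardLindelof.of_time_independent (fun y _ => ?_) (hK.lipschitzOnWith) ?_
      · exact (hM y).trans (Real.le_coe_toNNReal M)
      · simp
    obtain ⟨γ, h1, h2⟩ := hp.exists_eq_forall_mem_Icc_hasDerivWithinAt₀
    refine ⟨γ, h1, fun t ht => ?_⟩
    have ht' : t ∈ Ioo (-|a|) |a| := by
      have := le_abs_self a
      exact ⟨by linarith [ht.1], by linarith [ht.2]⟩
    have := (h2 t (Ioo_subset_Icc_self ht')).hasDerivAt (Icc_mem_nhds ht'.1 ht'.2)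
    exact this.hasFDerivAt.hasMFDerivAt.hasMFDerivWithinAt
  obtain ⟨γ, h1, h2⟩ := (exists_isMIntegralCurve_iff_exists_isMIntegralCurveOn_Ioo
    (contMDiff_vectorSpace_iff_contDiff.2 hv) x).2 hloc
  refine ⟨γ, h1, fun t => ?_⟩
  have h : HasFDerivAt γ ((1 : ℝ →L[ℝ] ℝ).smulRight (v (γ t))) t := (h2 t).hasFDerivAt
  simpa using h.hasDerivAt

end ODE

/-! ### Generalized inverses and kernels. -/

/-- Every linear map to a vector space has a reflexive generalized inverse. -/
theorem LinearMap.exists_generalized_inverse {k V W : Type*} [Field k] [AddCommGroup V]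
    [Module k V] [AddCommGroup W] [Module k W] (L : V →ₗ[k] W) :
    ∃ T : W →ₗ[k] V, L ∘ₗ T ∘ₗ L = L ∧ T ∘ₗ L ∘ₗ T = T := by
  obtain ⟨S, hS⟩ := L.rangeRestrict.exists_rightInverse_of_surjective L.range_rangeRestrict
  obtain ⟨p, hp⟩ := (LinearMap.range L).subtype.exists_leftInverse_of_injective
    (Submodule.ker_subtype _)
  have h1 : ∀ y : LinearMap.range L, L (S y) = y := fun y =>
    congrArg Subtype.val (LinearMap.congr_fun hS y)
  have h2 : ∀ y : LinearMap.range L, p y = y := fun y => LinearMap.congr_fun hp y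
  refine ⟨S ∘ₗ p, ?_, ?_⟩
  · ext v
    have := h2 ⟨L v, v, rfl⟩
    simp only at this
    simp [this, h1]
  · ext y
    simp [h1, h2]

/-- If `T L` factors through `A` with `rank A ≤ rank L`, then `A` vanishes on the kernel of `L`. -/
theorem LinearMap.eq_zero_of_comp_eq_of_finrank_range_le {k E Y : Type*} [Field k]
    [AddCommGroup E] [Module k E] [FiniteDimensional k E] [AddCommGroup Y] [Module k Y]
    {A L : E →ₗ[k] Y} {T : Y →ₗ[k] E}
    (hL : L ∘ₗ T ∘ₗ L = L) (hA : T ∘ₗ A = T ∘ₗ L)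
    (hr : Module.finrank k (LinearMap.range A) ≤ Module.finrank k (LinearMap.range L))
    {v : E} (hv : L v = 0) : A v = 0 := by
  -- `L T A = L` gives `ker A ≤ ker L`; by rank–nullity the rank bound makes the two kernels equal.
  have hTA : L ∘ₗ T ∘ₗ A = L := by rw [hA, hL]
  have hle : LinearMap.ker A ≤ LinearMap.ker L := fun w hw => by
    have := LinearMap.congr_fun hTA w
    rw [LinearMap.mem_ker] at hw ⊢
    simpa [hw] using this.symm
  have h1 := A.finrank_range_add_finrank_ker
  have h2 := L.finrank_range_add_finrank_ker
  have := Submodule.eq_of_le_of_finrank_le hle (by omega)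
  have hv' : v ∈ LinearMap.ker L := hv
  rw [← this] at hv'
  exact hv'

/-! ### Tangency of the image at a point of maximal rank. -/

section ConstantRank

variable {E Y : Type*} [NormedAddCommGroup E] [NormedSpace ℝ E] [FiniteDimensional ℝ E]
  [NormedAddCommGroup Y] [NormedSpace ℝ Y] [FiniteDimensional ℝ Y]

/-- The image of a map whose differential has maximal rank at `a` is tangent to the range of the
differential at `a`. -/
theorem ContDiff.exists_isLittleO_of_finrank_range_le {F : E → Y} (hF : ContDiff ℝ 1 F) (a : E)
    (hr : ∀ q, Module.finrank ℝ (fderiv ℝ F q).range ≤ Module.finrank ℝ (fderiv ℝ F a).range) :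
    ∃ T : Y →L[ℝ] E, (fun p => F p - F a - fderiv ℝ F a (T (F p - F a))) =o[𝓝 a]
      fun p => F p - F a := by
  set L := fderiv ℝ F a with hLdef
  obtain ⟨T₀, hT1, hT2⟩ := (L : E →ₗ[ℝ] Y).exists_generalized_inverse
  set T : Y →L[ℝ] E := LinearMap.toContinuousLinearMap T₀ with hTdef
  have hLTL : ∀ v, L (T (L v)) = L v := fun v => LinearMap.congr_fun hT1 v
  have hTLT : ∀ y, T (L (T y)) = T y := fun y => LinearMap.congr_fun hT2 y
  refine ⟨T, ?_⟩
  -- A chart at `a`: its derivative there is the identity, and `T L Φ = T F`, so that `T F` becomes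
  -- the linear map `T L` in these coordinates.
  set Φ : E → E := fun p => p - T (L p) + T (F p) with hΦ
  have hFd : HasFDerivAt F L a := (hF.differentiable one_ne_zero a).hasFDerivAt
  have hΦc : ContDiffAt ℝ 1 Φ a :=
    ((contDiff_id.sub (T.contDiff.comp L.contDiff)).add (T.contDiff.comp hF)).contDiffAt
  have hΦd : HasFDerivAt Φ ((ContinuousLinearEquiv.refl ℝ E : E ≃L[ℝ] E) : E →L[ℝ] E) a := by
    have := ((hasFDerivAt_id (𝕜 := ℝ) a).sub ((T.comp L).hasFDerivAt)).add
      (T.hasFDerivAt.comp a hFd)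
    refine this.congr_fderiv ?_
    ext v
    simp
  set Ψ := hΦc.localInverse hΦd one_ne_zero with hΨ
  have hstrict := hΦc.hasStrictFDerivAt' hΦd one_ne_zero
  have hΨc : ContDiffAt ℝ 1 Ψ (Φ a) := hΦc.to_localInverse hΦd one_ne_zero
  have hΨa : Ψ (Φ a) = a := hΦc.localInverse_apply_image hΦd one_ne_zero
  have hΨd : HasFDerivAt Ψ (ContinuousLinearMap.id ℝ E) (Φ a) := hstrict.to_localInverse.hasFDerivAt
  have hleft : ∀ᶠ p in 𝓝 a, Ψ (Φ p) = p := hstrict.eventually_left_inverse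
  have hright : ∀ᶠ x in 𝓝 (Φ a), Φ (Ψ x) = x := hstrict.eventually_right_inverse
  have hTΦ : ∀ p, T (L (Φ p)) = T (F p) := fun p => by simp [hΦ, hLTL, hTLT]
  set g : E → Y := F ∘ Ψ with hg
  have hgc : ContDiffAt ℝ 1 g (Φ a) := hF.contDiffAt.comp _ hΨc
  have hgd : fderiv ℝ g (Φ a) = L := by
    have h : HasFDerivAt F L (Ψ (Φ a)) := by rw [hΨa]; exact hFd
    simpa using (h.comp _ hΨd).fderiv
  -- near `Φ a` the differential of `g` factors through `T L`
  have hfac : ∀ᶠ x in 𝓝 (Φ a), DifferentiableAt ℝ g x ∧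
      ∀ v, fderiv ℝ g x v = fderiv ℝ g x (T (L v)) := by
    filter_upwards [hright.eventually_nhds, hΨc.eventually (by simp)] with x hx1 hx2
    have hΨx : DifferentiableAt ℝ Ψ x := hx2.differentiableAt one_ne_zero
    have hFx : DifferentiableAt ℝ F (Ψ x) := hF.differentiable one_ne_zero _
    have hgx : DifferentiableAt ℝ g x := hFx.comp x hΨx
    refine ⟨hgx, fun v => ?_⟩
    have hTg : (fun y => T (g y)) =ᶠ[𝓝 x] fun y => T (L y) := by
      filter_upwards [hx1] with y hy
      rw [hg, Function.comp_apply, ← hTΦ, hy]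
    have hTA : T.comp (fderiv ℝ g x) = T.comp L := by
      have h1 : HasFDerivAt (fun y => T (g y)) (T.comp (fderiv ℝ g x)) x :=
        T.hasFDerivAt.comp x hgx.hasFDerivAt
      have h2 : HasFDerivAt (fun y => T (L y)) (T.comp L) x := (T.comp L).hasFDerivAt
      exact h1.unique (h2.congr_of_eventuallyEq hTg)
    -- Maximality of the rank at `a` enters here; it makes `fderiv ℝ g x` vanish on `ker L`, which
    -- contains `v - T (L v)`.
    have hrank : Module.finrank ℝ (fderiv ℝ g x).range ≤ Module.finrank ℝ L.range := by
      refine le_trans (Submodule.finrank_mono ?_) (hr (Ψ x))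
      rw [hg, fderiv_comp x hFx hΨx]
      rintro _ ⟨w, rfl⟩
      exact ⟨fderiv ℝ Ψ x w, rfl⟩
    have := LinearMap.eq_zero_of_comp_eq_of_finrank_range_le (A := (fderiv ℝ g x : E →ₗ[ℝ] Y))
      (L := (L : E →ₗ[ℝ] Y)) (T := T₀) hT1
      (LinearMap.ext fun w => DFunLike.congr_fun hTA w) hrank
      (v := v - T (L v)) (by simp [hLTL])
    simpa [sub_eq_zero] using this
  -- A projection that kills the range of `L`, hence kills `fderiv ℝ g` at `Φ a` and nearly kills it
  -- close by.
  set N : Y →L[ℝ] Y := ContinuousLinearMap.id ℝ Y - L.comp T with hN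
  have hsmall : ∀ ε > 0, ∀ᶠ x in 𝓝 (Φ a), ‖N.comp (fderiv ℝ g x)‖ < ε := by
    intro ε hε
    have hcont : ContinuousAt (fun x => ‖N.comp (fderiv ℝ g x)‖) (Φ a) :=
      ((continuousAt_const (y := N)).clm_comp
        (hgc.continuousAt_fderiv one_ne_zero)).norm
    refine hcont.eventually_lt continuousAt_const ?_
    have : N.comp L = 0 := by ext v; simp [hN, hLTL]
    simp [hgd, this, hε]
  have hΦcont : ContinuousAt Φ a := hΦc.continuousAt
  rw [Asymptotics.isLittleO_iff]
  intro ε hε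
  have hε' : 0 < ε / (‖T‖ + 1) := by positivity
  obtain ⟨η, hη, hball⟩ := Metric.eventually_nhds_iff_ball.1 (hfac.and (hsmall _ hε'))
  filter_upwards [hleft, hΦcont.eventually (ball_mem_nhds _ hη)] with p hp hpη
  set u := Φ p - Φ a with hu
  have hseg : ∀ t ∈ Icc (0 : ℝ) 1, Φ a + t • u ∈ ball (Φ a) η := by
    intro t ht
    rw [dist_eq_norm] at hpη
    rw [mem_ball_iff_norm, add_sub_cancel_left, norm_smul, Real.norm_of_nonneg ht.1]
    exact lt_of_le_of_lt (mul_le_of_le_one_left (norm_nonneg _) ht.2) hpη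
  have hder : ∀ t ∈ Icc (0 : ℝ) 1, HasDerivWithinAt (fun t : ℝ => N (g (Φ a + t • u)))
      (N (fderiv ℝ g (Φ a + t • u) u)) (Icc 0 1) t := by
    intro t ht
    have h1 : HasDerivAt (fun t : ℝ => Φ a + t • u) u t := by
      simpa using ((hasDerivAt_id t).smul_const u).const_add (Φ a)
    have h2 := (hball _ (hseg t ht)).1.1.hasFDerivAt.comp_hasDerivAt t h1
    exact (N.hasFDerivAt.comp_hasDerivAt t h2).hasDerivWithinAt
  -- Only the part `T (L u)` of the increment moves `g`, and it equals `T (F p - F a)`. This yields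
  -- an error `o(F p - F a)` rather than merely `o(p - a)`.
  have hTLu : T (L u) = T (F p - F a) := by simp [hu, hTΦ]
  have := norm_image_sub_le_of_norm_deriv_le_segment_01' hder
    (C := ε / (‖T‖ + 1) * ‖T (L u)‖) fun t ht => by
      have ht' := hball _ (hseg t (Ico_subset_Icc_self ht))
      rw [ht'.1.2]
      exact (N.comp (fderiv ℝ g (Φ a + t • u))).le_of_opNorm_le ht'.2.le _
  simp only [one_smul, zero_smul, add_zero] at this
  rw [hu, add_sub_cancel, hg, Function.comp_apply, Function.comp_apply, hp, hΨa, ← map_sub,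
    ← hu, hTLu] at this
  calc ‖F p - F a - L (T (F p - F a))‖ = ‖N (F p - F a)‖ := rfl
    _ ≤ ε / (‖T‖ + 1) * ‖T (F p - F a)‖ := this
    _ ≤ ε / (‖T‖ + 1) * (‖T‖ * ‖F p - F a‖) := by gcongr; exact T.le_opNorm _
    _ = ε * ‖F p - F a‖ * (‖T‖ / (‖T‖ + 1)) := by ring
    _ ≤ ε * ‖F p - F a‖ * 1 := by
        gcongr
        exact div_le_one_of_le₀ (by linarith) (by positivity)
    _ = _ := mul_one _

end ConstantRank

/-! ### Coercivity on a subspace and near it. -/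

section Coercivity

variable {Y : Type*} [NormedAddCommGroup Y] [InnerProductSpace ℝ Y]

/-- A quadratic form that is positive on a finite-dimensional subspace is coercive there. -/
theorem Submodule.exists_mul_sq_norm_le_inner [FiniteDimensional ℝ Y] (W : Submodule ℝ Y)
    (A : Y →L[ℝ] Y) (h : ∀ w ∈ W, w ≠ 0 → 0 < inner ℝ w (A w)) :
    ∃ c > 0, ∀ w ∈ W, c * ‖w‖ ^ 2 ≤ inner ℝ w (A w) := by
  have hcomp : IsCompact (sphere (0 : Y) 1 ∩ (W : Set Y)) :=
    (isCompact_sphere 0 1).inter_right W.closed_of_finiteDimensional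
  have hcont : Continuous fun w : Y => inner ℝ w (A w) := by fun_prop
  obtain ⟨c, hc, hmin⟩ : ∃ c > 0, ∀ w ∈ sphere (0 : Y) 1 ∩ (W : Set Y), c ≤ inner ℝ w (A w) := by
    rcases (sphere (0 : Y) 1 ∩ (W : Set Y)).eq_empty_or_nonempty with h0 | h0
    · exact ⟨1, one_pos, by simp [h0]⟩
    · obtain ⟨w₀, hw₀, hm⟩ := hcomp.exists_isMinOn h0 hcont.continuousOn
      refine ⟨_, h w₀ hw₀.2 ?_, hm⟩
      rintro rfl
      simpa using hw₀.1
  refine ⟨c, hc, fun w hw => ?_⟩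
  rcases eq_or_ne w 0 with rfl | hw0
  · simp
  have hn : ‖w‖ ≠ 0 := norm_ne_zero_iff.2 hw0
  have := hmin (‖w‖⁻¹ • w) ⟨by simp [norm_smul, hn], W.smul_mem _ hw⟩
  rw [map_smul, inner_smul_left, inner_smul_right] at this
  have h2 : inner ℝ w (A w) = ‖w‖ ^ 2 * (‖w‖⁻¹ * (‖w‖⁻¹ * inner ℝ w (A w))) := by
    field_simp
  rw [h2, mul_comm]
  gcongr
  simpa using this

/-- Coercivity of a continuous family of quadratic forms on vectors that are nearly tangent to a
subspace on which one of the forms is coercive. -/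
theorem exists_eventually_mul_sq_norm_le_inner {E : Type*} [TopologicalSpace E] {a : E}
    {A : E → Y →L[ℝ] Y} (hA : ContinuousAt A a) {S : Y → Y} {c₀ : ℝ} (hc₀ : 0 < c₀)
    (hS : ∀ y, c₀ * ‖S y‖ ^ 2 ≤ inner ℝ (S y) (A a (S y)))
    {e : E → Y} (he : (fun p => e p - S (e p)) =o[𝓝 a] e) :
    ∃ c > 0, ∀ᶠ p in 𝓝 a, c * ‖e p‖ ^ 2 ≤ inner ℝ (e p) (A p (e p)) := by
  set M := ‖A a‖ with hM
  have hM0 : 0 ≤ M := norm_nonneg _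
  -- `ε ≤ 1/2` keeps `‖w‖` between `n/2` and `2n`, so the main term is at least `c₀/4 n²`; the three
  -- error terms cost `(2M + M + 1) ε n²`, at most `c₀/8 n²`.
  obtain ⟨ε, hε, hε1, hε2⟩ : ∃ ε > 0, ε ≤ 1 / 2 ∧ (3 * M + 1) * ε ≤ c₀ / 8 := by
    refine ⟨min (1 / 2) (c₀ / 8 / (3 * M + 1)), by positivity, min_le_left _ _, ?_⟩
    calc (3 * M + 1) * min (1 / 2) (c₀ / 8 / (3 * M + 1))
        ≤ (3 * M + 1) * (c₀ / 8 / (3 * M + 1)) := by gcongr; exact min_le_right _ _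
      _ = c₀ / 8 := by field_simp
  have hAε : ∀ᶠ p in 𝓝 a, ‖A p - A a‖ < ε := by
    have : ContinuousAt (fun p => ‖A p - A a‖) a := (hA.sub continuousAt_const).norm
    exact this.eventually_lt continuousAt_const (by simpa using hε)
  refine ⟨c₀ / 8, by positivity, ?_⟩
  filter_upwards [hAε, Asymptotics.isLittleO_iff.1 he hε] with p hp1 hp2
  set y := e p
  set w := S y
  set s := y - w with hs
  set n := ‖y‖ with hn
  have hn0 : 0 ≤ n := norm_nonneg _
  have hw1 : n / 2 ≤ ‖w‖ := by
    have : n ≤ ‖s‖ + ‖w‖ := by simpa [hs, hn] using norm_add_le s w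
    nlinarith
  have hw2 : ‖w‖ ≤ 2 * n := by
    have : ‖w‖ ≤ n + ‖s‖ := by simpa [hs, hn] using norm_sub_le y s
    nlinarith
  have hdec : inner ℝ y (A p y) = inner ℝ w (A a w) + inner ℝ s (A a w) + inner ℝ y (A a s) +
      inner ℝ y ((A p - A a) y) := by
    simp only [hs, inner_sub_left, map_sub, inner_sub_right, _root_.sub_apply]
    ring
  have hb : ∀ (u v : Y) (B : Y →L[ℝ] Y), -(‖u‖ * (‖B‖ * ‖v‖)) ≤ inner ℝ u (B v) := by
    intro u v B
    have h1 := neg_le_of_abs_le (abs_real_inner_le_norm u (B v))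
    have h2 := mul_le_mul_of_nonneg_left (B.le_opNorm v) (norm_nonneg u)
    linarith
  have t0 : c₀ / 4 * n ^ 2 ≤ inner ℝ w (A a w) := by
    refine le_trans ?_ (hS y)
    have : (n / 2) ^ 2 ≤ ‖w‖ ^ 2 := by gcongr
    nlinarith
  have t1 : -(2 * (M * ε * n ^ 2)) ≤ inner ℝ s (A a w) := by
    refine le_trans ?_ (hb s w (A a))
    have : ‖s‖ * (M * ‖w‖) ≤ (ε * n) * (M * (2 * n)) := by gcongr
    linarith
  have t2 : -(M * ε * n ^ 2) ≤ inner ℝ y (A a s) := by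
    refine le_trans ?_ (hb y s (A a))
    have : n * (M * ‖s‖) ≤ n * (M * (ε * n)) := by gcongr
    linarith
  have t3 : -(ε * n ^ 2) ≤ inner ℝ y ((A p - A a) y) := by
    refine le_trans ?_ (hb y y (A p - A a))
    have : n * (‖A p - A a‖ * n) ≤ n * (ε * n) := by gcongr
    linarith
  have t4 := mul_le_mul_of_nonneg_right hε2 (sq_nonneg n)
  linarith

end Coercivity

/-! ### Dissipation, confinement and convergence. -/

section Stability

variable {E Y : Type*} [NormedAddCommGroup E] [NormedSpace ℝ E]
  [NormedAddCommGroup Y] [InnerProductSpace ℝ Y]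

/-- A curve whose squared norm is dissipated with rate `2 c` decays exponentially. -/
theorem norm_le_mul_exp_of_dissipation {e e' : ℝ → Y} {c T : ℝ}
    (hec : ContinuousOn e (Icc 0 T)) (he : ∀ t ∈ Ioo 0 T, HasDerivAt e (e' t) t)
    (he' : ∀ t ∈ Ioo 0 T, inner ℝ (e t) (e' t) ≤ -(c * ‖e t‖ ^ 2)) {t : ℝ} (ht : t ∈ Icc 0 T) :
    ‖e t‖ ≤ ‖e 0‖ * Real.exp (-c * t) := by
  have hanti : AntitoneOn (fun t => Real.exp (2 * c * t) * ‖e t‖ ^ 2) (Icc 0 T) := by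
    have hd : ∀ t ∈ Ioo 0 T, HasDerivAt (fun t => Real.exp (2 * c * t) * ‖e t‖ ^ 2)
        (Real.exp (2 * c * t) * (2 * c) * ‖e t‖ ^ 2 +
          Real.exp (2 * c * t) * (2 * inner ℝ (e t) (e' t))) t := fun t ht => by
      have h1 : HasDerivAt (fun t : ℝ => Real.exp (2 * c * t))
          (Real.exp (2 * c * t) * (2 * c)) t := by
        simpa using ((hasDerivAt_id t).const_mul (2 * c)).exp
      exact h1.mul (he t ht).norm_sq
    refine antitoneOn_of_deriv_nonpos (convex_Icc 0 T) (by fun_prop) ?_ ?_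
    · rw [interior_Icc]
      exact fun t ht => (hd t ht).differentiableAt.differentiableWithinAt
    · rw [interior_Icc]
      intro t ht
      rw [(hd t ht).deriv]
      have := mul_le_mul_of_nonneg_left (he' t ht) (Real.exp_pos (2 * c * t)).le
      linarith
  have h := hanti (left_mem_Icc.2 (ht.1.trans ht.2)) ht ht.1
  simp only [mul_zero, Real.exp_zero, one_mul] at h
  refine le_of_sq_le_sq ?_ (by positivity)
  have hmul : Real.exp (-c * t) ^ 2 * Real.exp (2 * c * t) = 1 := by
    rw [← Real.exp_nat_mul, ← Real.exp_add, Real.exp_eq_one_iff]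
    push_cast
    ring
  calc ‖e t‖ ^ 2 = Real.exp (-c * t) ^ 2 * (Real.exp (2 * c * t) * ‖e t‖ ^ 2) := by
        rw [← mul_assoc, hmul, one_mul]
    _ ≤ Real.exp (-c * t) ^ 2 * ‖e 0‖ ^ 2 := by gcongr
    _ = _ := by ring

/-- Along a curve `x` on `[0, T]` with speed at most `C ‖e‖`, where `e` satisfies a dissipation
inequality with rate `c`, the displacement is exponentially small. -/
theorem norm_sub_le_of_dissipation {x : ℝ → E} {e : ℝ → Y} {x' : ℝ → E} {e' : ℝ → Y} {c C T : ℝ}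
    (hc : 0 < c) (hC : 0 ≤ C)
    (hxc : ContinuousOn x (Icc 0 T)) (hec : ContinuousOn e (Icc 0 T))
    (hx : ∀ t ∈ Ico 0 T, HasDerivWithinAt x (x' t) (Ici t) t)
    (he : ∀ t ∈ Ioo 0 T, HasDerivAt e (e' t) t)
    (hx' : ∀ t ∈ Ico 0 T, ‖x' t‖ ≤ C * ‖e t‖)
    (he' : ∀ t ∈ Ioo 0 T, inner ℝ (e t) (e' t) ≤ -(c * ‖e t‖ ^ 2))
    {s t : ℝ} (hs : 0 ≤ s) (hst : s ≤ t) (ht : t ≤ T) :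
    ‖x t - x s‖ ≤ C / c * ‖e 0‖ * (Real.exp (-c * s) - Real.exp (-c * t)) := by
  have hexp : ∀ t, HasDerivAt (fun t : ℝ => Real.exp (-c * t)) (Real.exp (-c * t) * -c) t :=
    fun t => by simpa using ((hasDerivAt_id t).const_mul (-c)).exp
  have hdecay := fun t => norm_le_mul_exp_of_dissipation (t := t) hec he he'
  have hsub : Icc s t ⊆ Icc 0 T := Icc_subset_Icc hs ht
  -- The bound is the integral over `[s, r]` of the speed estimate `C ‖e 0‖ exp(-c r)`.
  have hB : ∀ r, HasDerivAt
      (fun r : ℝ => C / c * ‖e 0‖ * (Real.exp (-c * s) - Real.exp (-c * r)))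
      (C * (‖e 0‖ * Real.exp (-c * r))) r := fun r => by
    refine (((hexp r).const_sub (Real.exp (-c * s))).const_mul (C / c * ‖e 0‖)).congr_deriv ?_
    field_simp
  refine image_norm_le_of_norm_deriv_right_le_deriv_boundary' (f := fun r => x r - x s) (f' := x')
    (a := s) (b := t) ((hxc.mono hsub).sub continuousOn_const) (fun r hr => ?_) (by simp)
    (fun r _ => (hB r).continuousAt.continuousWithinAt) (fun r _ => (hB r).hasDerivWithinAt)
    (fun r hr => ?_) (right_mem_Icc.2 hst)
  · exact (hx r ⟨hs.trans hr.1, hr.2.trans_le ht⟩).sub_const _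
  · have hr' : r ∈ Ico 0 T := ⟨hs.trans hr.1, hr.2.trans_le ht⟩
    exact (hx' r hr').trans (by gcongr; exact hdecay r (Ico_subset_Icc_self hr'))

/-- Curves that solve `x' = X x` while they are in a ball, on which an error function `e` is
dissipated and controls the speed, remain in the ball and move exponentially little,
while the error decays exponentially. -/
theorem mem_ball_and_norm_sub_le_of_dissipation {X : E → E} {e : E → Y} (he : Differentiable ℝ e)
    {a : E} {ρ c C : ℝ} (hc : 0 < c) (hC : 0 ≤ C)
    (hX : ∀ p ∈ ball a ρ, ‖X p‖ ≤ C * ‖e p‖)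
    (hdiss : ∀ p ∈ ball a ρ, inner ℝ (e p) (fderiv ℝ e p (X p)) ≤ -(c * ‖e p‖ ^ 2))
    {x : ℝ → E} (hxc : ContinuousOn x (Ici 0))
    (hx : ∀ t, 0 ≤ t → x t ∈ ball a ρ → HasDerivWithinAt x (X (x t)) (Ici 0) t)
    (h0 : ‖x 0 - a‖ + C / c * ‖e (x 0)‖ < ρ) :
    (∀ t, 0 ≤ t → x t ∈ ball a ρ) ∧ ∀ s t, 0 ≤ s → s ≤ t →
      ‖x t - x s‖ ≤ C / c * ‖e (x 0)‖ * (Real.exp (-c * s) - Real.exp (-c * t)) ∧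
        ‖e (x t)‖ ≤ ‖e (x 0)‖ * Real.exp (-c * t) := by
  -- Membership is required only on `Ico 0 T`, so the estimates still hold at a first exit time `T`.
  have key : ∀ T, (∀ t ∈ Ico 0 T, x t ∈ ball a ρ) → ∀ s t, 0 ≤ s → s ≤ t → t ≤ T →
      ‖x t - x s‖ ≤ C / c * ‖e (x 0)‖ * (Real.exp (-c * s) - Real.exp (-c * t)) ∧
        ‖e (x t)‖ ≤ ‖e (x 0)‖ * Real.exp (-c * t) := by
    intro T hT s t hs hst ht
    have hxT : ContinuousOn x (Icc 0 T) := hxc.mono Icc_subset_Ici_self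
    have heT : ContinuousOn (fun t => e (x t)) (Icc 0 T) := he.continuous.comp_continuousOn hxT
    have hed : ∀ t ∈ Ioo 0 T, HasDerivAt (fun t => e (x t)) (fderiv ℝ e (x t) (X (x t))) t :=
      fun t ht => (he (x t)).hasFDerivAt.comp_hasDerivAt t
        ((hx t ht.1.le (hT t (Ioo_subset_Ico_self ht))).hasDerivAt (Ici_mem_nhds ht.1))
    have hdx := fun t ht => hdiss _ (hT t (Ioo_subset_Ico_self ht))
    exact ⟨norm_sub_le_of_dissipation (x' := fun t => X (x t)) hc hC hxT heT
      (fun t ht => (hx t ht.1 (hT t ht)).mono (Ici_subset_Ici.2 ht.1)) hed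
      (fun t ht => hX _ (hT t ht)) hdx hs hst ht,
      norm_le_mul_exp_of_dissipation heT hed hdx ⟨hs.trans hst, ht⟩⟩
  have hmem : ∀ t, 0 ≤ t → x t ∈ ball a ρ := by
    by_contra! hcon
    -- The infimum of this closed set is the first exit time; by then the displacement is at most `C
    -- / c * ‖e (x 0)‖`, too little to reach radius `ρ`.
    set S := {t : ℝ | 0 ≤ t ∧ ρ ≤ ‖x t - a‖} with hS
    have hne : S.Nonempty := by
      obtain ⟨t, ht, h⟩ := hcon
      exact ⟨t, ht, by simpa [dist_eq_norm] using h⟩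
    have hbdd : BddBelow S := ⟨0, fun t ht => ht.1⟩
    have hcl : IsClosed S :=
      ((hxc.sub continuousOn_const).norm).preimage_isClosed_of_isClosed isClosed_Ici isClosed_Ici
    have hT := hcl.csInf_mem hne hbdd
    set T := sInf S
    have h1 := (key T (fun t ht => by
      by_contra h
      exact absurd (csInf_le hbdd ⟨ht.1, by simpa [dist_eq_norm] using h⟩) (not_le.2 ht.2))
      0 T le_rfl hT.1 le_rfl).1
    have h2 : C / c * ‖e (x 0)‖ * (Real.exp (-c * 0) - Real.exp (-c * T)) ≤ C / c * ‖e (x 0)‖ := by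
      refine mul_le_of_le_one_right (by positivity) ?_
      have := Real.exp_pos (-c * T)
      simp only [mul_zero, Real.exp_zero]
      linarith
    have h3 := norm_sub_le_norm_sub_add_norm_sub (x T) (x 0) a
    linarith [hT.2]
  exact ⟨hmem, fun s t hs hst => key t (fun r hr => hmem r hr.1) s t hs hst le_rfl⟩

/-- Local exponential stability of the zero set of `F - F a` for the field
`p ↦ -D p (F p - F a)`, when the rank of the differential of `F` is maximal at `a` and the
linearized error dynamics is dissipative on its range. -/
theorem exists_exponential_stability [FiniteDimensional ℝ E] [FiniteDimensional ℝ Y]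
    {F : E → Y} (hF : ContDiff ℝ 1 F) {D : E → Y →L[ℝ] E} (hD : ContDiff ℝ 1 D) (a : E)
    (hr : ∀ q, Module.finrank ℝ (fderiv ℝ F q).range ≤ Module.finrank ℝ (fderiv ℝ F a).range)
    (hpos : ∀ w ∈ (fderiv ℝ F a).range, w ≠ 0 → 0 < inner ℝ w (fderiv ℝ F a (D a w))) :
    ∃ δ > 0, ∃ K > 0, ∃ k > 0, ∀ p₀ ∈ ball a δ,
      (∃ x : ℝ → E, x 0 = p₀ ∧
        ∀ t, 0 ≤ t → HasDerivWithinAt x (-(D (x t) (F (x t) - F a))) (Ici 0) t) ∧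
      ∀ x : ℝ → E, x 0 = p₀ →
        (∀ t, 0 ≤ t → HasDerivWithinAt x (-(D (x t) (F (x t) - F a))) (Ici 0) t) →
        ∃ q, F q = F a ∧ ∀ t, 0 ≤ t → ‖x t - q‖ ≤ K * Real.exp (-k * t) := by
  set e : E → Y := fun p => F p - F a with he
  set X : E → E := fun p => -(D p (e p)) with hX
  have heC : ContDiff ℝ 1 e := hF.sub contDiff_const
  have hXC : ContDiff ℝ 1 X := (hD.clm_apply heC).neg
  have hed : ∀ p, fderiv ℝ e p = fderiv ℝ F p := fun p => fderiv_sub_const _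
  obtain ⟨T, hT⟩ := hF.exists_isLittleO_of_finrank_range_le a hr
  obtain ⟨c₀, hc₀, hcoer⟩ := Submodule.exists_mul_sq_norm_le_inner
    (fderiv ℝ F a).range ((fderiv ℝ F a).comp (D a)) hpos
  obtain ⟨c, hc, hev⟩ := exists_eventually_mul_sq_norm_le_inner
    (A := fun p => (fderiv ℝ F p).comp (D p)) (S := fun y => fderiv ℝ F a (T y))
    (((hF.continuous_fderiv one_ne_zero).clm_comp hD.continuous).continuousAt) hc₀
    (fun y => hcoer _ ⟨T y, rfl⟩) hT
  set C := ‖D a‖ + 1 with hCdef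
  have hC : 0 ≤ C := by positivity
  have hDC : ∀ᶠ p in 𝓝 a, ‖D p‖ < C :=
    hD.continuous.norm.continuousAt.eventually_lt continuousAt_const (lt_add_one _)
  obtain ⟨ρ, hρ, hball⟩ := Metric.eventually_nhds_iff_ball.1 (hev.and hDC)
  have hXle : ∀ p ∈ ball a ρ, ‖X p‖ ≤ C * ‖e p‖ := fun p hp => by
    rw [hX, norm_neg]
    exact (D p).le_of_opNorm_le (hball p hp).2.le _
  have hdiss : ∀ p ∈ ball a ρ, inner ℝ (e p) (fderiv ℝ e p (X p)) ≤ -(c * ‖e p‖ ^ 2) :=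
    fun p hp => by
      rw [hed, hX, map_neg, inner_neg_right]
      exact neg_le_neg (hball p hp).1
  have hinit : ∀ᶠ p in 𝓝 a, ‖p - a‖ + C / c * ‖e p‖ < ρ := by
    have hcont : Continuous fun p => ‖p - a‖ + C / c * ‖e p‖ := by
      have := heC.continuous
      fun_prop
    exact hcont.continuousAt.eventually_lt continuousAt_const (by simpa [he] using hρ)
  obtain ⟨δ, hδ, hδball⟩ := Metric.eventually_nhds_iff_ball.1 hinit
  have hediff := heC.differentiable one_ne_zero
  -- `ρ` can serve as `K` because the choice of `δ` forces `C / c * ‖e (x 0)‖ < ρ`.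
  refine ⟨δ, hδ, ρ, hρ, c, hc, fun p₀ hp₀ => ⟨?_, fun x hx0 hx => ?_⟩⟩
  -- Cutting `X` off outside the ball gives a global solution; confinement keeps it where the cutoff
  -- is `1`, so it solves the original equation.
  · let f : ContDiffBump a := ⟨ρ, ρ + 1, hρ, lt_add_one ρ⟩
    obtain ⟨γ, hγ0, hγ⟩ := (f.contDiff.smul hXC).exists_forall_hasDerivAt_of_hasCompactSupport
      f.hasCompactSupport.smul_right p₀
    have hγX : ∀ t, γ t ∈ ball a ρ → HasDerivAt γ (X (γ t)) t := fun t ht => by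
      have := hγ t
      rwa [Pi.smul_apply', f.one_of_mem_closedBall (ball_subset_closedBall ht), one_smul] at this
    have hmem := (mem_ball_and_norm_sub_le_of_dissipation hediff hc hC hXle hdiss (x := γ)
      (fun t _ => (hγ t).continuousAt.continuousWithinAt)
      (fun t _ ht => (hγX t ht).hasDerivWithinAt) (by rw [hγ0]; exact hδball _ hp₀)).1
    exact ⟨γ, hγ0, fun t ht => (hγX t (hmem t ht)).hasDerivWithinAt⟩
  · have hp := hδball _ hp₀
    rw [← hx0] at hp
    have hest := (mem_ball_and_norm_sub_le_of_dissipation hediff hc hC hXle hdiss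
      (fun t ht => (hx t ht).continuousWithinAt) (fun t ht _ => hx t ht) hp).2
    have hest' : ∀ s t, 0 ≤ s → s ≤ t → ‖x t - x s‖ ≤ ρ * Real.exp (-c * s) := by
      intro s t hs hst
      refine (hest s t hs hst).1.trans ?_
      have h1 : C / c * ‖e (x 0)‖ ≤ ρ := by linarith [norm_nonneg (x 0 - a)]
      have h2 := Real.exp_pos (-c * t)
      have h3 : Real.exp (-c * t) ≤ Real.exp (-c * s) := Real.exp_le_exp.2 (by nlinarith)
      exact mul_le_mul h1 (by linarith) (by linarith) hρ.le
    have hexp : Tendsto (fun n : ℕ => Real.exp (-c * n)) atTop (𝓝 0) :=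
      Real.tendsto_exp_atBot.comp
        (tendsto_natCast_atTop_atTop.const_mul_atTop_of_neg (neg_lt_zero.2 hc))
    have hcauchy : CauchySeq fun n : ℕ => x n := by
      refine cauchySeq_of_le_tendsto_0' (fun n : ℕ => ρ * Real.exp (-c * n)) (fun n m hnm => ?_)
        (by simpa using hexp.const_mul ρ)
      rw [dist_comm, dist_eq_norm]
      exact hest' n m n.cast_nonneg (Nat.cast_le.2 hnm)
    obtain ⟨q, hq⟩ := cauchySeq_tendsto_of_complete hcauchy
    refine ⟨q, ?_, fun t ht => ?_⟩
    · have h1 : Tendsto (fun n : ℕ => ‖e (x n)‖) atTop (𝓝 ‖e q‖) :=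
        (heC.continuous.norm.tendsto q).comp hq
      have h2 : Tendsto (fun n : ℕ => ‖e (x n)‖) atTop (𝓝 0) :=
        squeeze_zero (fun _ => norm_nonneg _)
          (fun n => (hest 0 n le_rfl n.cast_nonneg).2) (by simpa using hexp.const_mul ‖e (x 0)‖)
      exact sub_eq_zero.1 (norm_eq_zero.1 (tendsto_nhds_unique h1 h2))
    · rw [norm_sub_rev]
      -- The later time in `hest'` tends to infinity through integers while `t` stays real.
      refine le_of_tendsto ((hq.sub_const (x t)).norm) ?_
      filter_upwards [eventually_ge_atTop ⌈t⌉₊] with n hn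
      exact hest' t n ht (Nat.ceil_le.1 hn)

end Stability

/-! ### The distance map and the directed controller in Euclidean coordinates. -/

/-- The rank of the differential is invariant under linear changes of the target space. -/
theorem finrank_range_fderiv_comp {E Y Y' : Type*} [NormedAddCommGroup E] [NormedSpace ℝ E]
    [NormedAddCommGroup Y] [NormedSpace ℝ Y] [NormedAddCommGroup Y'] [NormedSpace ℝ Y']
    (φ : Y ≃L[ℝ] Y') (f : E → Y) (p : E) :
    Module.finrank ℝ (fderiv ℝ (φ ∘ f) p).range = Module.finrank ℝ (fderiv ℝ f p).range := by
  rw [φ.comp_fderiv]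
  change Module.finrank ℝ (LinearMap.range ((φ.toLinearEquiv : Y →ₗ[ℝ] Y') ∘ₗ
    (fderiv ℝ f p : E →ₗ[ℝ] Y))) = _
  rw [LinearMap.range_comp, LinearEquiv.finrank_map_eq]

namespace FormationControl

section

variable {V : Type*} {d : ℕ} {G : SimpleGraph V}

theorem distanceMap_mk (p : Config V d) {i j : V}
    (h : s(i, j) ∈ G.edgeSet) :
    distanceMap G p ⟨s(i, j), h⟩ = ∑ k, (p (j, k) - p (i, k)) ^ 2 := by
  simp [distanceMap, pos, EuclideanSpace.norm_sq_eq]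

section

variable [DecidableEq V]

theorem rigidityMatrix_mk (p : Config V d) {i j : V} (h : s(i, j) ∈ G.edgeSet) (c : V × Fin d) :
    rigidityMatrix G p ⟨s(i, j), h⟩ c =
      ((if c.1 = i then 1 else 0) - (if c.1 = j then 1 else 0)) * (p (i, c.2) - p (j, c.2)) :=
  rfl

end

variable [Fintype V]

section

variable [Fintype G.edgeSet]

/-- The distance map with values in the Euclidean space of edge vectors. -/
noncomputable def euclideanDistanceMap (G : SimpleGraph V) [Fintype G.edgeSet] (p : Config V d) : EuclideanSpace ℝ G.edgeSet :=
  WithLp.toLp 2 (distanceMap G p)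

theorem contDiff_euclideanDistanceMap :
    ContDiff ℝ 1 (euclideanDistanceMap G : Config V d → _) := by
  rw [contDiff_euclidean]
  rintro ⟨e, he⟩
  induction e with
  | _ i j =>
    simp only [euclideanDistanceMap, distanceMap_mk]
    fun_prop

/-- Regularity refers to the sup-normed space `G.edgeSet → ℝ`, while dissipation needs an inner
product; this carries the rank condition across. -/
theorem finrank_range_fderiv_euclideanDistanceMap (p : Config V d) :
    Module.finrank ℝ (fderiv ℝ (euclideanDistanceMap G) p).range =
      Module.finrank ℝ
        (fderiv ℝ (distanceMap G : Config V d → G.edgeSet → ℝ) p).range := by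
  exact finrank_range_fderiv_comp (PiLp.continuousLinearEquiv 2 ℝ fun _ : G.edgeSet => ℝ).symm
    (distanceMap G) p

end

variable [DecidableEq V]

/-- Twice this sum is the derivative of the squared edge length in the direction `v`, whence `dF =
2R`. -/
theorem rigidityMatrix_mulVec_mk (p v : Config V d) {i j : V} (h : s(i, j) ∈ G.edgeSet) :
    (rigidityMatrix G p *ᵥ v.ofLp) ⟨s(i, j), h⟩ =
      ∑ k, (p (i, k) - p (j, k)) * (v (i, k) - v (j, k)) := by
  simp only [Matrix.mulVec, dotProduct, rigidityMatrix_mk]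
  rw [Fintype.sum_prod_type, Finset.sum_comm]
  refine Finset.sum_congr rfl fun k _ => ?_
  simp only [sub_mul, ite_mul, one_mul, zero_mul, Finset.sum_sub_distrib, Finset.sum_ite_eq',
    Finset.mem_univ, if_true]
  ring

theorem contDiff_rigidityMatrix_apply (e : G.edgeSet) (c : V × Fin d) :
    ContDiff ℝ 1 fun p : Config V d => rigidityMatrix G p e c := by
  obtain ⟨e, he⟩ := e
  induction e with
  | _ i j =>
    simp only [rigidityMatrix_mk]
    fun_prop

variable [Fintype G.edgeSet]

/-- The transpose of the directed rigidity matrix as a linear map between Euclidean spaces. -/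
noncomputable def directedRigidityAdjoint (o : EdgeOrientation G) (p : Config V d) :
    EuclideanSpace ℝ G.edgeSet →L[ℝ] Config V d :=
  LinearMap.toContinuousLinearMap (Matrix.toEuclideanLin (directedRigidityMatrix o p)ᵀ)

theorem directedRigidityAdjoint_apply (o : EdgeOrientation G) (p : Config V d)
    (y : EuclideanSpace ℝ G.edgeSet) :
    directedRigidityAdjoint o p y = WithLp.toLp 2 ((directedRigidityMatrix o p)ᵀ *ᵥ y.ofLp) :=
  rfl

theorem contDiff_directedRigidityAdjoint (o : EdgeOrientation G) :
    ContDiff ℝ 1 (directedRigidityAdjoint o : Config V d → _) := by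
  rw [contDiff_clm_apply_iff]
  intro y
  rw [contDiff_euclidean]
  intro c
  simp only [directedRigidityAdjoint_apply, Matrix.mulVec, dotProduct, Matrix.transpose_apply,
    directedRigidityMatrix]
  refine ContDiff.sum fun e _ => ContDiff.mul ?_ contDiff_const
  split_ifs
  · exact contDiff_rigidityMatrix_apply e c
  · exact contDiff_const

/-- This is the form `-D p (F p - F a)` that `exists_exponential_stability` treats. -/
theorem directedField_eq (o : EdgeOrientation G) (a p : Config V d) :
    directedField o (distanceMap G a) p =
      -(directedRigidityAdjoint o p (euclideanDistanceMap G p - euclideanDistanceMap G a)) :=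
  rfl

theorem hasFDerivAt_euclideanDistanceMap (p : Config V d) :
    HasFDerivAt (euclideanDistanceMap G) ((2 : ℝ) •
      LinearMap.toContinuousLinearMap (Matrix.toEuclideanLin (rigidityMatrix G p))) p := by
  refine HasStrictFDerivAt.hasFDerivAt ?_
  rw [hasStrictFDerivAt_euclidean]
  rintro ⟨e, he⟩
  induction e with
  | _ i j =>
    simp only [euclideanDistanceMap, distanceMap_mk]
    have hpr : ∀ c : V × Fin d, HasStrictFDerivAt (fun q : Config V d => q c)
        (EuclideanSpace.proj c : Config V d →L[ℝ] ℝ) p :=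
      fun c => (EuclideanSpace.proj (𝕜 := ℝ) c).hasStrictFDerivAt
    have := HasStrictFDerivAt.fun_sum (u := Finset.univ) fun (k : Fin d) _ =>
      ((hpr (j, k)).sub (hpr (i, k))).pow 2
    refine this.congr_fderiv ?_
    ext v
    have h := rigidityMatrix_mulVec_mk p v he
    simp only [_root_.sum_apply, ContinuousLinearMap.comp_apply]
    change _ = 2 * (rigidityMatrix G p *ᵥ v.ofLp) ⟨s(i, j), he⟩
    rw [h, Finset.mul_sum]
    refine Finset.sum_congr rfl fun k _ => ?_
    simp
    ring

theorem fderiv_euclideanDistanceMap_apply (p v : Config V d) :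
    fderiv ℝ (euclideanDistanceMap G) p v =
      WithLp.toLp 2 ((2 : ℝ) • (rigidityMatrix G p *ᵥ v.ofLp)) := by
  rw [(hasFDerivAt_euclideanDistanceMap p).fderiv]
  rfl

/-- Positivity of the symmetric part of `Z`, compressed to the column space of the rigidity
matrix, is positivity of the linearized error dynamics on the range of the differential. -/
theorem inner_fderiv_directedRigidityAdjoint_pos {a : Config V d} (o : EdgeOrientation G)
    {r : ℕ} {P : Matrix G.edgeSet (Fin r) ℝ} (hP : IsColumnBasis P (rigidityMatrix G a))
    {Z : Matrix G.edgeSet G.edgeSet ℝ}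
    (hZ : Z = (2 : ℝ) • (rigidityMatrix G a * (directedRigidityMatrix o a)ᵀ))
    (hpos : ((1 / 2 : ℝ) • (Pᵀ * (Z + Zᵀ) * P)).PosDef)
    {w : EuclideanSpace ℝ G.edgeSet} (hw : w ∈ (fderiv ℝ (euclideanDistanceMap G) a).range)
    (hw0 : w ≠ 0) :
    0 < inner ℝ w (fderiv ℝ (euclideanDistanceMap G) a (directedRigidityAdjoint o a w)) := by
  have hwP : w.ofLp ∈ LinearMap.range P.mulVecLin := by
    obtain ⟨u, rfl⟩ := hw
    rw [Matrix.range_mulVecLin, hP.2, ← Matrix.range_mulVecLin]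
    -- The factor `2` of `dF = 2R` is absorbed into the preimage.
    refine ⟨(2 : ℝ) • u.ofLp, ?_⟩
    change rigidityMatrix G a *ᵥ ((2 : ℝ) • u.ofLp) =
      (fderiv ℝ (euclideanDistanceMap G) a u).ofLp
    rw [fderiv_euclideanDistanceMap_apply, Matrix.mulVec_smul]
  obtain ⟨y, hy⟩ := hwP
  rw [Matrix.mulVecLin_apply] at hy
  have hy0 : y ≠ 0 := by
    rintro rfl
    apply hw0
    ext e
    simpa using (congrFun hy e).symm
  have hZw : (fderiv ℝ (euclideanDistanceMap G) a (directedRigidityAdjoint o a w)).ofLp =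
      Z *ᵥ w.ofLp := by
    rw [fderiv_euclideanDistanceMap_apply, directedRigidityAdjoint_apply, hZ,
      Matrix.smul_mulVec, Matrix.mulVec_mulVec]
  have h := hpos.dotProduct_mulVec_pos hy0
  -- `Z` and its transpose have the same quadratic form, so with `w = P y` the hypothesis on the
  -- symmetric part is a statement about `Z` itself.
  have hsymm : w.ofLp ⬝ᵥ Zᵀ *ᵥ w.ofLp = w.ofLp ⬝ᵥ Z *ᵥ w.ofLp := by
    rw [Matrix.mulVec_transpose, dotProduct_comm, Matrix.dotProduct_mulVec]
  have key : star y ⬝ᵥ ((1 / 2 : ℝ) • (Pᵀ * (Z + Zᵀ) * P)) *ᵥ y = w.ofLp ⬝ᵥ Z *ᵥ w.ofLp := by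
    rw [star_trivial, Matrix.smul_mulVec, dotProduct_smul, ← Matrix.mulVec_mulVec,
      ← Matrix.mulVec_mulVec, hy, Matrix.dotProduct_mulVec, Matrix.vecMul_transpose, hy,
      Matrix.add_mulVec, dotProduct_add, hsymm, smul_eq_mul]
    ring
  rw [key] at h
  rw [EuclideanSpace.inner_eq_star_dotProduct, hZw, star_trivial, dotProduct_comm]
  exact h

end

end FormationControl

end

theorem theorem3 {V : Type*} [Fintype V] [DecidableEq V] (d : ℕ)
    (G : SimpleGraph V) [Fintype G.edgeSet]
    (hG : FormationControl.GenericallyRigid G d)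
    (pstar : FormationControl.Config V d)
    (hreg : FormationControl.IsRegularPoint G pstar)
    (o : FormationControl.EdgeOrientation G)
    (r : ℕ) (P : Matrix G.edgeSet (Fin r) ℝ)
    (hP : FormationControl.IsColumnBasis P (FormationControl.rigidityMatrix G pstar))
    (Z : Matrix G.edgeSet G.edgeSet ℝ)
    (hZ : Z = (2 : ℝ) • (FormationControl.rigidityMatrix G pstar *
      (FormationControl.directedRigidityMatrix o pstar)ᵀ))
    (hpos : ((1 / 2 : ℝ) • (Pᵀ * (Z + Zᵀ) * P)).PosDef) :
    ∃ δ > 0, ∃ K > 0, ∃ k > 0, ∀ p₀ ∈ Metric.ball pstar δ,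
      (∃ x : ℝ → FormationControl.Config V d,
        FormationControl.IsTrajectory o (FormationControl.distanceMap G pstar) p₀ x) ∧
      ∀ x : ℝ → FormationControl.Config V d,
        FormationControl.IsTrajectory o (FormationControl.distanceMap G pstar) p₀ x →
          ∃ q : FormationControl.Config V d,
            FormationControl.distanceMap G q = FormationControl.distanceMap G pstar ∧
            ∀ t : ℝ, 0 ≤ t → ‖x t - q‖ ≤ K * Real.exp (-k * t) := by
  obtain ⟨δ, hδ, K, hK, k, hk, h⟩ := exists_exponential_stability
    (FormationControl.contDiff_euclideanDistanceMap (G := G) (d := d))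
    (FormationControl.contDiff_directedRigidityAdjoint o) pstar
    (fun q => by
      simpa only [FormationControl.finrank_range_fderiv_euclideanDistanceMap] using hreg q)
    (fun w hw hw0 =>
      FormationControl.inner_fderiv_directedRigidityAdjoint_pos o hP hZ hpos hw hw0)
  refine ⟨δ, hδ, K, hK, k, hk, fun p₀ hp₀ => ⟨?_, fun x hx => ?_⟩⟩
  · simpa only [FormationControl.IsTrajectory, FormationControl.directedField_eq] using (h p₀ hp₀).1
  · simp only [FormationControl.IsTrajectory, FormationControl.directedField_eq] at hx
    obtain ⟨q, hq, hqx⟩ := (h p₀ hp₀).2 x hx.1 hx.2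
    exact ⟨q, WithLp.toLp_injective 2 hq, hqx⟩
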